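/- Let $V$ be a finite-dimensional real vector space, let $\mathbf P=\mathbf P(V)$ be its projective space with the quotient topology of $V\setminus\{0\}$, and let $\mathbf P^{*}=\mathbf P(V^{*})$ be the dual projective space. For distinct points $p=[u]$, $q=[v]$ of a projective space, the two line segments joining them are $\{[\lambda u+\mu v] : \lambda\mu\ge 0,\ (\lambda,\mu)\ne(0,0)\}$ and $\{[\lambda u+\mu v] : \lambda\mu\le 0,\ (\lambda,\mu)\ne(0,0)\}$. A subset $S$ is convex if any two distinct points of $S$ are joined by a line segment contained in $S$ and some projective hyperplane is disjoint from $S$. A convex set is saturated if for each point $p\notin S$ there is an open convex set that contains $S$ and does not contain $p$. A convex set $A$ is irreducible if, for all convex sets $B,C$, $A=B\cap C$ implies $A=B$ or $A=C$. For $S\subseteq\mathbf P$ let $$\Phi(S)=\{[f]\in\mathbf P^{*} : \text{the complement of the hyperplane } \{[v] : f(v)=0\} \text{ is an irreducible convex set containing } S\},$$ and for $T\subseteq\mathbf P^{*}$ define $\Phi(T)\subseteq\mathbf P$ in the same way, with the hyperplanes $\{[f] : f(v)=0\}$ of $\mathbf P^{*}$, $[v]\in\mathbf P$. Then $\Phi$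 restricts to an order anti-isomorphism (with respect to inclusion) from the nonempty saturated convex sets in $\mathbf P$ onto the nonempty saturated convex sets in $\mathbf P^{*}$, whose inverse is given by $\Phi$ on subsets of $\mathbf P^{*}$. It interchanges openness and closedness: for every nonempty saturated convex set $S$ in $\mathbf P$, $S$ is open if and only if $\Phi(S)$ is closed, and $S$ is closed if and only if $\Phi(S)$ is open. Moreover, $\Phi$ maps the nonempty open convex sets in $\mathbf P$ bijectively onto the nonempty closed convex sets in $\mathbf P^{*}$, and the nonempty closed convex sets in $\mathbf P$ bijectively onto the nonempty open convex sets in $\mathbf P^{*}$. -/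

import Mathlib

open Module Set
open scoped LinearAlgebra.Projectivization

namespace ProjConvex

/-- The usual topology of a real projective space: the quotient topology of `V \ {0}`, where `V`
carries its canonical vector space topology (for finite-dimensional `V`, the topology of any norm). -/
noncomputable instance projTopology {V : Type*} [AddCommGroup V] [Module ℝ V] : TopologicalSpace (ℙ ℝ V) :=
  TopologicalSpace.coinduced (Projectivization.mk' ℝ : {v : V // v ≠ 0} → ℙ ℝ V)
    (TopologicalSpace.induced Subtype.val (moduleTopology ℝ V))

theorem isOpen_iff_preimage {V : Type*} [AddCommGroup V] [Module ℝ V] [TopologicalSpace V]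
    [IsModuleTopology ℝ V] (S : Set (ℙ ℝ V)) :
    IsOpen S ↔ IsOpen ((Projectivization.mk' ℝ : {v : V // v ≠ 0} → ℙ ℝ V) ⁻¹' S) := by
  have h := eq_moduleTopology ℝ V
  subst h
  exact Iff.rfl

/-- The projective line segment `{π(a u + b v) | a b ≥ 0, (a, b) ≠ 0}`, where `u`, `v` represent
`p`, `q`. For distinct points `p`, `q`, changing `u`, `v` can only exchange `segmentPos p q` and
`segmentNeg p q`. -/
def segmentPos {V : Type*} [AddCommGroup V] [Module ℝ V] (p q : ℙ ℝ V) : Set (ℙ ℝ V) :=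
  {x | ∃ a b : ℝ, 0 ≤ a * b ∧ (a ≠ 0 ∨ b ≠ 0) ∧
    ∃ h : a • p.rep + b • q.rep ≠ 0, x = Projectivization.mk ℝ (a • p.rep + b • q.rep) h}

/-- The other projective line segment, `{π(a u + b v) | a b ≤ 0, (a, b) ≠ 0}`. -/
def segmentNeg {V : Type*} [AddCommGroup V] [Module ℝ V] (p q : ℙ ℝ V) : Set (ℙ ℝ V) :=
  {x | ∃ a b : ℝ, a * b ≤ 0 ∧ (a ≠ 0 ∨ b ≠ 0) ∧
    ∃ h : a • p.rep + b • q.rep ≠ 0, x = Projectivization.mk ℝ (a • p.rep + b • q.rep) h}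

/-- Any two distinct points of `S` are joined by a line segment contained in `S`. -/
def IsSemiconvex {V : Type*} [AddCommGroup V] [Module ℝ V] (S : Set (ℙ ℝ V)) : Prop :=
  ∀ p ∈ S, ∀ q ∈ S, p ≠ q → segmentPos p q ⊆ S ∨ segmentNeg p q ⊆ S

/-- Projective hyperplanes: projectivizations of linear subspaces of codimension one. -/
def IsHyperplane {V : Type*} [AddCommGroup V] [Module ℝ V] (h : Set (ℙ ℝ V)) : Prop :=
  ∃ H : Submodule ℝ V, finrank ℝ H + 1 = finrank ℝ V ∧ h = (H.projectivization : Set (ℙ ℝ V))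

/-- Projective convex sets. -/
def IsConvexSet {V : Type*} [AddCommGroup V] [Module ℝ V] (S : Set (ℙ ℝ V)) : Prop :=
  IsSemiconvex S ∧ ∃ h : Set (ℙ ℝ V), IsHyperplane h ∧ Disjoint h S

/-- Multi-convex sets: intersections of nonempty families of convex sets. -/
def IsMultiConvex {V : Type*} [AddCommGroup V] [Module ℝ V] (S : Set (ℙ ℝ V)) : Prop :=
  ∃ F : Set (Set (ℙ ℝ V)), F.Nonempty ∧ (∀ C ∈ F, IsConvexSet C) ∧ S = ⋂₀ F

/-- Saturated multi-convex sets. -/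
def IsSaturatedMultiConvex {V : Type*} [AddCommGroup V] [Module ℝ V] (S : Set (ℙ ℝ V)) : Prop :=
  IsMultiConvex S ∧ ∀ p ∉ S, ∃ U : Set (ℙ ℝ V), IsOpen U ∧ IsConvexSet U ∧ S ⊆ U ∧ p ∉ U

/-- Saturated convex sets: convex sets that are saturated as multi-convex sets. -/
def IsSaturatedConvex {V : Type*} [AddCommGroup V] [Module ℝ V] (S : Set (ℙ ℝ V)) : Prop :=
  IsConvexSet S ∧ IsSaturatedMultiConvex S

/-- Irreducible convex sets. -/
def IsIrreducibleConvex {V : Type*} [AddCommGroup V] [Module ℝ V] (A : Set (ℙ ℝ V)) : Prop :=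
  IsConvexSet A ∧
    ∀ B C : Set (ℙ ℝ V), IsConvexSet B → IsConvexSet C → A = B ∩ C → A = B ∨ A = C

/-- The hyperplane of `P = ℙ ℝ V` that corresponds to a point `q` of the dual projective space
`P* = ℙ ℝ (Dual ℝ V)`: the points at which the functionals representing `q` vanish. -/
def hyperplaneOfDual {V : Type*} [AddCommGroup V] [Module ℝ V] (q : ℙ ℝ (Dual ℝ V)) :
    Set (ℙ ℝ V) :=
  (q.submodule.dualCoannihilator.projectivization : Set (ℙ ℝ V))

/-- The hyperplane of `P*` that corresponds to a point `p` of `P`: the functionals, up to scaling,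
that vanish at `p`. -/
def hyperplaneOfPoint {V : Type*} [AddCommGroup V] [Module ℝ V] (p : ℙ ℝ V) :
    Set (ℙ ℝ (Dual ℝ V)) :=
  (p.submodule.dualAnnihilator.projectivization : Set (ℙ ℝ (Dual ℝ V)))

theorem mk_mem_hyperplaneOfDual {V : Type*} [AddCommGroup V] [Module ℝ V] (f : Dual ℝ V)
    (hf : f ≠ 0) (v : V) (hv : v ≠ 0) :
    Projectivization.mk ℝ v hv ∈ hyperplaneOfDual (Projectivization.mk ℝ f hf) ↔ f v = 0 := by
  simp only [hyperplaneOfDual, SetLike.mem_coe, Submodule.mk_mem_projectivization_iff,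
    Projectivization.submodule_mk, Submodule.mem_dualCoannihilator,
    Submodule.mem_span_singleton]
  constructor
  · intro h
    exact h f ⟨1, one_smul _ _⟩
  · rintro h _ ⟨c, rfl⟩
    simp [h]

theorem mk_mem_hyperplaneOfPoint {V : Type*} [AddCommGroup V] [Module ℝ V] (f : Dual ℝ V)
    (hf : f ≠ 0) (v : V) (hv : v ≠ 0) :
    Projectivization.mk ℝ f hf ∈ hyperplaneOfPoint (Projectivization.mk ℝ v hv) ↔ f v = 0 := by
  simp only [hyperplaneOfPoint, SetLike.mem_coe, Submodule.mk_mem_projectivization_iff,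
    Projectivization.submodule_mk, Submodule.mem_dualAnnihilator,
    Submodule.mem_span_singleton]
  constructor
  · intro h
    exact h v ⟨1, one_smul _ _⟩
  · rintro h _ ⟨c, rfl⟩
    simp [h]

/-- `Φ(S)`: the points of `P*` that correspond to the irreducible convex sets containing `S`. A point
`q` of `P*` corresponds to the irreducible convex set `C` if `C` is the complement of the hyperplane
of `q`. -/
def Phi {V : Type*} [AddCommGroup V] [Module ℝ V] (S : Set (ℙ ℝ V)) : Set (ℙ ℝ (Dual ℝ V)) :=
  {q | ∃ C : Set (ℙ ℝ V), IsIrreducibleConvex C ∧ S ⊆ C ∧ C = (hyperplaneOfDual q)ᶜ}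

/-- The function `Φ` in the other direction, from subsets of `P*` to subsets of `P`. -/
def PhiDual {V : Type*} [AddCommGroup V] [Module ℝ V] (T : Set (ℙ ℝ (Dual ℝ V))) : Set (ℙ ℝ V) :=
  {p | ∃ C : Set (ℙ ℝ (Dual ℝ V)), IsIrreducibleConvex C ∧ T ⊆ C ∧ C = (hyperplaneOfPoint p)ᶜ}

end ProjConvex

/-! Every hyperplane complement is an irreducible convex set, so `Phi S` is the set of all
hyperplanes missing `S`, that is, the polar of `S` (`Phi_eq_polar`). Treating an arbitrary perfect
pairing `p` together with `p.flip` makes both directions of Φ instances of one construction.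

Polarity is antitone and `S` lies in its bipolar; the point is equality. If the hyperplane `f = 0`
misses `S`, the half `f > 0` of the cone over `S` is convex (`convex_cone_inter_pos`). For open or
closed `S`, Hahn–Banach separates this half, or a compact slice of it, from the line through any
vector outside the cone, giving a hyperplane through that point and off `S`. Saturated sets inherit
bipolarity from the open convex sets around them (`polar_flip_polar`).

Polars are semiconvex because two functionals without zeros on `S` have constant relative sign there
(`mul_pos_of_mem_cone`), and saturated because they are intersections of open hyperplane
complements. Perturbing zeros sends open sets to closed polars; compactness sends closed sets to
open ones. -/

namespace ProjConvex

/-! ### Cones over projective sets and convexity -/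

section Cone

variable {V : Type*} [AddCommGroup V] [Module ℝ V]

/-- The nonzero vectors representing the points of a subset of a projective space. -/
def cone (S : Set (ℙ ℝ V)) : Set V :=
  {v | ∃ h : v ≠ 0, Projectivization.mk ℝ v h ∈ S}

theorem mk_mem_iff_mem_cone {S : Set (ℙ ℝ V)} {v : V} (hv : v ≠ 0) :
    Projectivization.mk ℝ v hv ∈ S ↔ v ∈ cone S :=
  ⟨fun h ↦ ⟨hv, h⟩, fun ⟨_, h⟩ ↦ h⟩

theorem rep_mem_cone_iff {S : Set (ℙ ℝ V)} {x : ℙ ℝ V} : x.rep ∈ cone S ↔ x ∈ S := by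
  rw [← mk_mem_iff_mem_cone x.rep_nonzero, x.mk_rep]

theorem cone_nonempty {S : Set (ℙ ℝ V)} (hS : S.Nonempty) : (cone S).Nonempty :=
  let ⟨_, hx⟩ := hS
  ⟨_, rep_mem_cone_iff.2 hx⟩

theorem cone_mono {S T : Set (ℙ ℝ V)} (h : S ⊆ T) : cone S ⊆ cone T :=
  fun _ ⟨hv, hS⟩ ↦ ⟨hv, h hS⟩

theorem subset_of_cone_subset {S T : Set (ℙ ℝ V)} (h : cone S ⊆ cone T) : S ⊆ T :=
  fun _ hx ↦ rep_mem_cone_iff.1 (h (rep_mem_cone_iff.2 hx))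

theorem smul_mem_cone {S : Set (ℙ ℝ V)} {v : V} (hv : v ∈ cone S) {c : ℝ} (hc : c ≠ 0) :
    c • v ∈ cone S := by
  obtain ⟨h, hS⟩ := hv
  refine ⟨smul_ne_zero hc h, ?_⟩
  rwa [(Projectivization.mk_eq_mk_iff' ℝ (c • v) v _ h).2 ⟨c, rfl⟩]

theorem exists_eq_smul_rep {v : V} (hv : v ≠ 0) :
    ∃ c : ℝ, c ≠ 0 ∧ v = c • (Projectivization.mk ℝ v hv).rep := by
  obtain ⟨a, ha⟩ := Projectivization.exists_smul_eq_mk_rep ℝ v hv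
  exact ⟨(a⁻¹ : ℝˣ), (a⁻¹).ne_zero, by rw [← ha, ← Units.smul_def, inv_smul_smul]⟩

/-- Semiconvexity in terms of representatives, which need not be independent. -/
theorem IsSemiconvex.cone_dichotomy {S : Set (ℙ ℝ V)} (hS : IsSemiconvex S) {u v : V}
    (hu : u ∈ cone S) (hv : v ∈ cone S) :
    (∀ a b : ℝ, 0 ≤ a * b → a • u + b • v ≠ 0 → a • u + b • v ∈ cone S) ∨
      (∀ a b : ℝ, a * b ≤ 0 → a • u + b • v ≠ 0 → a • u + b • v ∈ cone S) := by
  by_cases hpq : Projectivization.mk ℝ u hu.1 = Projectivization.mk ℝ v hv.1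
  · obtain ⟨c, rfl⟩ := (Projectivization.mk_eq_mk_iff' ℝ u v hu.1 hv.1).1 hpq
    refine Or.inl fun a b _ hne ↦ ?_
    have e : a • c • v + b • v = (a * c + b) • v := by module
    rw [e] at hne ⊢
    exact smul_mem_cone hv (left_ne_zero_of_smul hne)
  obtain ⟨c, hc, ec⟩ := exists_eq_smul_rep hu.1
  obtain ⟨d, hd, ed⟩ := exists_eq_smul_rep hv.1
  set p := Projectivization.mk ℝ u hu.1
  set q := Projectivization.mk ℝ v hv.1
  have key (a b : ℝ) : a • u + b • v = (a * c) • p.rep + (b * d) • q.rep := by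
    rw [ec, ed, smul_smul, smul_smul]
  have nz {a b : ℝ} (h : a • u + b • v ≠ 0) : a * c ≠ 0 ∨ b * d ≠ 0 := by
    by_contra! h'
    exact h (by rw [key, h'.1, h'.2]; simp)
  have hprod (a b : ℝ) : a * c * (b * d) = a * b * (c * d) := by ring
  have pos (h : segmentPos p q ⊆ S) {a b : ℝ} (hab : 0 ≤ a * b * (c * d))
      (hne : a • u + b • v ≠ 0) : a • u + b • v ∈ cone S := by
    have hn := nz hne
    rw [key] at hne ⊢
    exact ⟨hne, h ⟨a * c, b * d, by rwa [hprod], hn, hne, rfl⟩⟩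
  have neg (h : segmentNeg p q ⊆ S) {a b : ℝ} (hab : a * b * (c * d) ≤ 0)
      (hne : a • u + b • v ≠ 0) : a • u + b • v ∈ cone S := by
    have hn := nz hne
    rw [key] at hne ⊢
    exact ⟨hne, h ⟨a * c, b * d, by rwa [hprod], hn, hne, rfl⟩⟩
  -- Rescaling the representatives by `c` and `d` exchanges the two segments exactly when `c * d <
  -- 0`.
  rcases lt_or_gt_of_ne (mul_ne_zero hc hd) with hcd | hcd <;>
    rcases hS p hu.2 q hv.2 hpq with h | h
  · exact Or.inr fun a b hab ↦ pos h (mul_nonneg_of_nonpos_of_nonpos hab hcd.le)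
  · exact Or.inl fun a b hab ↦ neg h (mul_nonpos_of_nonneg_of_nonpos hab hcd.le)
  · exact Or.inl fun a b hab ↦ pos h (mul_nonneg hab hcd.le)
  · exact Or.inr fun a b hab ↦ neg h (mul_nonpos_of_nonpos_of_nonneg hab hcd.le)

theorem isSemiconvex_of_cone_dichotomy {S : Set (ℙ ℝ V)}
    (h : ∀ u ∈ cone S, ∀ v ∈ cone S,
      (∀ a b : ℝ, 0 ≤ a * b → a • u + b • v ≠ 0 → a • u + b • v ∈ cone S) ∨
        (∀ a b : ℝ, a * b ≤ 0 → a • u + b • v ≠ 0 → a • u + b • v ∈ cone S)) :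
    IsSemiconvex S := by
  intro p hp q hq _
  refine (h _ (rep_mem_cone_iff.2 hp) _ (rep_mem_cone_iff.2 hq)).imp (fun h ↦ ?_) fun h ↦ ?_ <;>
  · rintro _ ⟨a, b, hab, -, hne, rfl⟩
    exact (h a b hab hne).2

theorem isSemiconvex_singleton (x : ℙ ℝ V) : IsSemiconvex {x} := by
  rintro p rfl q rfl h
  exact absurd rfl h

/-- Between two points with `f > 0`, the segment with coefficients of opposite signs crosses `f =
0`, so `S` must contain the other one. -/
theorem convex_cone_inter_pos {S : Set (ℙ ℝ V)} (hS : IsSemiconvex S) (f : Dual ℝ V)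
    (hf : ∀ v ∈ cone S, f v ≠ 0) : Convex ℝ {v | v ∈ cone S ∧ 0 < f v} := by
  rintro u ⟨hu, fu⟩ v ⟨hv, fv⟩ a b ha hb hab
  have hpos : 0 < f (a • u + b • v) := by
    simp only [map_add, map_smul, smul_eq_mul]
    rcases ha.eq_or_lt with rfl | ha
    · simpa [show b = 1 by linarith] using fv
    · exact add_pos_of_pos_of_nonneg (mul_pos ha fu) (mul_nonneg hb fv.le)
  have hne : a • u + b • v ≠ 0 := fun h ↦ by simp [h] at hpos
  refine ⟨?_, hpos⟩
  rcases hS.cone_dichotomy hu hv with h | h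
  · exact h a b (mul_nonneg ha hb) hne
  by_cases h0 : f v • u + (-f u) • v = 0
  · have hv' : u = (f u / f v) • v := by
      have : f v • u = f u • v := by
        rw [neg_smul] at h0
        exact add_neg_eq_zero.1 h0
      rw [div_eq_inv_mul, mul_smul, ← this, inv_smul_smul₀ fv.ne']
    have e : a • u + b • v = (a * (f u / f v) + b) • v := by
      rw [add_smul, mul_smul, ← hv']
    rw [e] at hne ⊢
    exact smul_mem_cone hv (left_ne_zero_of_smul hne)
  · refine absurd ?_ (hf _ (h (f v) (-f u) (by nlinarith [mul_pos fu fv]) h0))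
    simp only [map_add, map_smul, smul_eq_mul]
    ring

/-- Two functionals without zeros on a semiconvex set have a constant relative sign there. -/
theorem mul_pos_of_mem_cone {S : Set (ℙ ℝ V)} (hS : IsSemiconvex S) (f g : Dual ℝ V)
    (hf : ∀ v ∈ cone S, f v ≠ 0) (hg : ∀ v ∈ cone S, g v ≠ 0) {u v : V} (hu : u ∈ cone S)
    (hv : v ∈ cone S) (h : 0 < f u * g u) : 0 < f v * g v := by
  by_contra hneg
  have hlt : f v * g v < 0 :=
    lt_of_le_of_ne (not_lt.1 hneg) (mul_ne_zero (hf v hv) (hg v hv))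
  have hprod : (f v * f u) * (g v * g u) < 0 := by nlinarith [mul_pos_of_neg_of_neg hlt (neg_neg_of_pos h)]
  -- The line through `u` and `v` meets `f = 0` and `g = 0` in these two points. By `hprod` their
  -- coefficient products have opposite signs, so each segment contains one of them.
  have ef : f (f v • u + (-f u) • v) = 0 := by simp; ring
  have eg : g (g v • u + (-g u) • v) = 0 := by simp; ring
  have hcross : f v * g u ≠ f u * g v := fun e ↦ by
    have : f v * f u * (g v * g u) = (f u * g v) * (f u * g v) := by
      linear_combination f u * g v * e
    nlinarith [mul_self_nonneg (f u * g v)]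
  have nf : f v • u + (-f u) • v ≠ 0 := fun h0 ↦ by
    have := congrArg g h0
    simp only [map_add, map_smul, smul_eq_mul, map_zero] at this
    exact hcross (by linarith)
  have ng : g v • u + (-g u) • v ≠ 0 := fun h0 ↦ by
    have := congrArg f h0
    simp only [map_add, map_smul, smul_eq_mul, map_zero] at this
    exact hcross (by linarith)
  rcases lt_or_gt_of_ne (left_ne_zero_of_mul hprod.ne) with hl | hl
  · have hr : 0 < g v * g u := pos_of_mul_neg_right hprod hl.le
    rcases hS.cone_dichotomy hu hv with H | H
    · exact hf _ (H _ _ (by linarith) nf) ef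
    · exact hg _ (H _ _ (by linarith) ng) eg
  · have hr : g v * g u < 0 := (pos_iff_neg_of_mul_neg hprod).1 hl
    rcases hS.cone_dichotomy hu hv with H | H
    · exact hg _ (H _ _ (by linarith) ng) eg
    · exact hf _ (H _ _ (by linarith) nf) ef

theorem isHyperplane_iff [FiniteDimensional ℝ V] {h : Set (ℙ ℝ V)} :
    IsHyperplane h ↔ ∃ f : Dual ℝ V, f ≠ 0 ∧ h = (f.ker.projectivization : Set (ℙ ℝ V)) := by
  constructor
  · rintro ⟨H, hH, rfl⟩
    obtain ⟨f, hf, hle⟩ := H.exists_le_ker_of_lt_top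
      (Submodule.lt_top_of_finrank_lt_finrank (by omega))
    have := Module.Dual.finrank_ker_add_one_of_ne_zero hf
    exact ⟨f, hf, by rw [Submodule.eq_of_le_of_finrank_eq hle (by omega)]⟩
  · rintro ⟨f, hf, rfl⟩
    exact ⟨f.ker, Module.Dual.finrank_ker_add_one_of_ne_zero hf, rfl⟩

theorem disjoint_ker_projectivization_iff {f : Dual ℝ V} {S : Set (ℙ ℝ V)} :
    Disjoint (f.ker.projectivization : Set (ℙ ℝ V)) S ↔ ∀ v ∈ cone S, f v ≠ 0 := by
  rw [Set.disjoint_right]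
  constructor
  · rintro h v ⟨hv, hS⟩ h0
    exact h hS h0
  · intro h x hx hk
    induction x with | h v hv => exact h v ⟨hv, hx⟩ hk

theorem isConvexSet_iff [FiniteDimensional ℝ V] {S : Set (ℙ ℝ V)} :
    IsConvexSet S ↔ IsSemiconvex S ∧ ∃ f : Dual ℝ V, f ≠ 0 ∧ ∀ v ∈ cone S, f v ≠ 0 := by
  refine and_congr_right fun _ ↦ ⟨?_, ?_⟩
  · rintro ⟨h, hh, hd⟩
    obtain ⟨f, hf, rfl⟩ := isHyperplane_iff.1 hh
    exact ⟨f, hf, disjoint_ker_projectivization_iff.1 hd⟩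
  · rintro ⟨f, hf, hd⟩
    exact ⟨_, isHyperplane_iff.2 ⟨f, hf, rfl⟩, disjoint_ker_projectivization_iff.2 hd⟩

theorem IsConvexSet.isSaturatedConvex {S : Set (ℙ ℝ V)} (hS : IsConvexSet S)
    (h : ∀ x ∉ S, ∃ U : Set (ℙ ℝ V), IsOpen U ∧ IsConvexSet U ∧ S ⊆ U ∧ x ∉ U) :
    IsSaturatedConvex S :=
  ⟨hS, ⟨{S}, singleton_nonempty S, by simpa using hS, by simp⟩, h⟩

end Cone

/-! ### Topology of the projective space through cones -/

section Topology

variable {V : Type*} [AddCommGroup V] [Module ℝ V] [FiniteDimensional ℝ V] [TopologicalSpace V]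
  [IsModuleTopology ℝ V]

/-- Coordinates, as a homeomorphism. -/
theorem exists_coordinates (V : Type*) [AddCommGroup V] [Module ℝ V] [FiniteDimensional ℝ V]
    [TopologicalSpace V] [IsModuleTopology ℝ V] :
    ∃ e : V ≃ₗ[ℝ] (Fin (finrank ℝ V) → ℝ), Continuous e ∧ Continuous e.symm := by
  have := IsModuleTopology.topologicalAddGroup ℝ V
  let e := (finBasis ℝ V).equivFun
  exact ⟨e, IsModuleTopology.continuous_of_linearMap e.toLinearMap,
    IsModuleTopology.continuous_of_linearMap e.symm.toLinearMap⟩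

theorem t2Space_of_isModuleTopology : T2Space V := by
  obtain ⟨e, he, -⟩ := exists_coordinates V
  exact T2Space.of_injective_continuous e.injective he

theorem locallyConvexSpace_of_isModuleTopology : LocallyConvexSpace ℝ V := by
  obtain ⟨e, he, he'⟩ := exists_coordinates V
  have h : Topology.IsInducing e.toLinearMap :=
    (Homeomorph.mk e.toEquiv he he').isInducing
  have := LocallyConvexSpace.induced (𝕜 := ℝ) e.toLinearMap
  convert this
  exact h.eq_induced

/-- A compact set of nonzero vectors that represent all points of the projective space. -/
theorem exists_isCompact_representatives (V : Type*) [AddCommGroup V] [Module ℝ V]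
    [FiniteDimensional ℝ V] [TopologicalSpace V] [IsModuleTopology ℝ V] :
    ∃ K : Set V, IsCompact K ∧ (∀ v ∈ K, v ≠ 0) ∧ ∀ v : V, v ≠ 0 → ∃ c : ℝ, c ≠ 0 ∧ c • v ∈ K := by
  obtain ⟨e, he, he'⟩ := exists_coordinates V
  refine ⟨e.symm '' Metric.sphere 0 1, (isCompact_sphere _ _).image he', ?_, fun v hv ↦ ?_⟩
  · rintro _ ⟨x, hx, rfl⟩ h0
    rw [e.symm.map_eq_zero_iff] at h0
    simp [h0] at hx
  · have hn : ‖e v‖ ≠ 0 := by simpa using hv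
    refine ⟨‖e v‖⁻¹, inv_ne_zero hn, ‖e v‖⁻¹ • e v, ?_, by simp⟩
    rw [mem_sphere_zero_iff_norm, norm_smul, norm_inv, norm_norm, inv_mul_cancel₀ hn]

theorem isOpen_iff_isOpen_cone {S : Set (ℙ ℝ V)} : IsOpen S ↔ IsOpen (cone S) := by
  have := t2Space_of_isModuleTopology (V := V)
  have ho : IsOpen {v : V | v ≠ 0} := isOpen_ne
  have e : cone S =
      Subtype.val '' ((Projectivization.mk' ℝ : {v : V // v ≠ 0} → ℙ ℝ V) ⁻¹' S) := by
    ext v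
    simp [cone, Projectivization.mk'_eq_mk]
  rw [isOpen_iff_preimage, e]
  exact ho.isOpenEmbedding_subtypeVal.isOpen_iff_image_isOpen

/-- Stands in for compactness of a closed set in projective space: only an open cone is removed from
`K`. -/
theorem isCompact_inter_cone {S : Set (ℙ ℝ V)} (hS : IsClosed S) {K : Set V} (hK : IsCompact K)
    (h0 : ∀ v ∈ K, v ≠ 0) : IsCompact (K ∩ cone S) := by
  have e : K ∩ cone S = K \ cone Sᶜ := by
    ext v
    refine and_congr_right fun hv ↦ ?_
    rw [← mk_mem_iff_mem_cone (h0 v hv), ← mk_mem_iff_mem_cone (h0 v hv)]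
    simp
  rw [e]
  exact hK.diff (isOpen_iff_isOpen_cone.1 hS.isOpen_compl)

end Topology

/-! ### Polarity for a pairing -/

section Polar

variable {V W : Type*} [AddCommGroup V] [Module ℝ V] [AddCommGroup W] [Module ℝ W]

/-- The points of `ℙ ℝ W` whose hyperplanes, with respect to a pairing, are disjoint from `S`. -/
def polar (p : V →ₗ[ℝ] W →ₗ[ℝ] ℝ) (S : Set (ℙ ℝ V)) : Set (ℙ ℝ W) :=
  {y | ∀ v ∈ cone S, p v y.rep ≠ 0}

variable (p : V →ₗ[ℝ] W →ₗ[ℝ] ℝ)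

theorem mem_cone_polar {S : Set (ℙ ℝ V)} {w : W} :
    w ∈ cone (polar p S) ↔ w ≠ 0 ∧ ∀ v ∈ cone S, p v w ≠ 0 := by
  refine ⟨fun ⟨hw, h⟩ ↦ ⟨hw, fun v hv h0 ↦ h v hv ?_⟩, fun ⟨hw, h⟩ ↦ ⟨hw, fun v hv h0 ↦ h v hv ?_⟩⟩
  all_goals obtain ⟨c, hc, e⟩ := exists_eq_smul_rep hw
  · rw [e, map_smul] at h0
    exact (smul_eq_zero.1 h0).resolve_left hc
  · rw [e, map_smul, h0, smul_zero]

theorem mk_mem_polar_singleton {v : V} (hv : v ≠ 0) {w : W} (hw : w ≠ 0) :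
    Projectivization.mk ℝ w hw ∈ polar p {Projectivization.mk ℝ v hv} ↔ p v w ≠ 0 := by
  rw [mk_mem_iff_mem_cone, mem_cone_polar]
  refine ⟨fun h ↦ h.2 v ⟨hv, rfl⟩, fun h ↦ ⟨hw, ?_⟩⟩
  rintro u ⟨hu, hmem⟩
  obtain ⟨c, rfl⟩ := (Projectivization.mk_eq_mk_iff' ℝ u v hu hv).1 hmem
  have hc : c ≠ 0 := left_ne_zero_of_smul hu
  simpa [hc] using h

theorem polar_anti {S T : Set (ℙ ℝ V)} (h : S ⊆ T) : polar p T ⊆ polar p S :=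
  fun _ hy v hv ↦ hy v (cone_mono h hv)

theorem subset_polar_flip_polar (S : Set (ℙ ℝ V)) : S ⊆ polar p.flip (polar p S) :=
  subset_of_cone_subset fun v hv ↦ (mem_cone_polar _).2
    ⟨hv.1, fun _ hw ↦ ((mem_cone_polar p).1 hw).2 v hv⟩

/-- Two functionals without zeros on `S` agree in sign on all of `S`, perhaps after negating one;
combinations with coefficients of the matching sign then have no zeros there either. The point `v₀`
decides which segment to take. -/
theorem isSemiconvex_polar {S : Set (ℙ ℝ V)} (hne : S.Nonempty) (hS : IsSemiconvex S) :
    IsSemiconvex (polar p S) := by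
  obtain ⟨v₀, hv₀⟩ := cone_nonempty hne
  refine isSemiconvex_of_cone_dichotomy fun u hu w hw ↦ ?_
  rw [mem_cone_polar] at hu hw
  simp only [mem_cone_polar]
  have hsign {a b x y : ℝ} (hab : 0 ≤ a * b) (hxy : 0 < x * y) (h : a * x + b * y = 0) :
      a = 0 ∧ b = 0 := by
    have hy : y ≠ 0 := right_ne_zero_of_mul hxy.ne'
    have ha : a = 0 := by
      by_contra ha
      -- Multiplied by `a * y`, the relation becomes a²·xy + ab·y² = 0, with first term positive and
      -- second nonnegative.
      nlinarith [mul_pos (mul_self_pos.2 ha) hxy, mul_nonneg hab (mul_self_nonneg y),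
        congrArg (· * (a * y)) h]
    refine ⟨ha, ?_⟩
    simpa [ha, hy] using h
  rcases lt_or_gt_of_ne (mul_ne_zero (hu.2 v₀ hv₀) (hw.2 v₀ hv₀)) with h | h
  · refine Or.inr fun a b hab hn ↦ ⟨hn, fun v hv h0 ↦ hn ?_⟩
    have hpos := mul_pos_of_mem_cone hS (p.flip u) (p.flip (-w)) hu.2
      (fun v hv ↦ by simpa using hw.2 v hv) hv₀ hv (by simpa using h)
    obtain ⟨ha, hb⟩ := hsign (a := a) (b := -b) (by linarith) hpos (by simpa using h0)
    rw [ha, neg_eq_zero.1 hb]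
    simp
  · refine Or.inl fun a b hab hn ↦ ⟨hn, fun v hv h0 ↦ hn ?_⟩
    have hpos := mul_pos_of_mem_cone hS (p.flip u) (p.flip w) hu.2 hw.2 hv₀ hv h
    obtain ⟨ha, hb⟩ := hsign hab hpos (by simpa using h0)
    rw [ha, hb]
    simp

theorem exists_flip_eq [p.IsPerfPair] (f : Dual ℝ V) : ∃ w : W, p.flip w = f :=
  (LinearMap.IsPerfPair.bijective_right p).surjective f

theorem pairing_ne_zero [p.IsPerfPair] {v : V} (hv : v ≠ 0) : p v ≠ 0 := fun h ↦
  hv ((LinearMap.IsPerfPair.bijective_left p).injective (h.trans p.map_zero.symm))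

theorem isConvexSet_polar [FiniteDimensional ℝ W] [p.IsPerfPair] {S : Set (ℙ ℝ V)}
    (hne : S.Nonempty) (hS : IsSemiconvex S) : IsConvexSet (polar p S) := by
  obtain ⟨v, hv⟩ := cone_nonempty hne
  exact isConvexSet_iff.2 ⟨isSemiconvex_polar p hne hS, p v, pairing_ne_zero p hv.1,
    fun w hw ↦ ((mem_cone_polar p).1 hw).2 v hv⟩

theorem polar_nonempty [FiniteDimensional ℝ V] [p.IsPerfPair] {S : Set (ℙ ℝ V)}
    (hS : IsConvexSet S) : (polar p S).Nonempty := by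
  obtain ⟨-, f, hf, h⟩ := isConvexSet_iff.1 hS
  obtain ⟨w, rfl⟩ := exists_flip_eq p f
  have hw : w ≠ 0 := fun h0 ↦ hf (by rw [h0, map_zero])
  exact ⟨_, (mk_mem_iff_mem_cone hw).2 ((mem_cone_polar p).2 ⟨hw, h⟩)⟩

/-- A point `[u]` of the bipolar of `[v]` satisfies ker `p u` ⊆ ker `p v`, so the two functionals
are proportional. -/
theorem polar_flip_polar_singleton_subset [p.IsPerfPair] (x : ℙ ℝ V) :
    polar p.flip (polar p {x}) ⊆ {x} := by
  intro y h
  induction x with | h v hv =>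
  induction y with | h u hu =>
  rw [mk_mem_iff_mem_cone, mem_cone_polar] at h
  have hker (w : W) (hw : p u w = 0) : p v w = 0 := by
    by_contra hvw
    have hw0 : w ≠ 0 := fun h0 ↦ hvw (by rw [h0, map_zero])
    exact h.2 w ((mk_mem_iff_mem_cone hw0).1 ((mk_mem_polar_singleton p hv hw0).2 hvw)) hw
  obtain ⟨w₀, hw₀⟩ : ∃ w₀, p v w₀ ≠ 0 := by
    by_contra! h0
    exact pairing_ne_zero p hv (LinearMap.ext h0)
  have hu₀ : p u w₀ ≠ 0 := fun h0 ↦ hw₀ (hker _ h0)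
  refine (Projectivization.mk_eq_mk_iff' ℝ u v hu hv).2 ⟨p u w₀ / p v w₀, ?_⟩
  refine (LinearMap.IsPerfPair.bijective_left p).injective (LinearMap.ext fun w ↦ ?_)
  have := hker (p u w • w₀ - p u w₀ • w) (by simp; ring)
  simp only [map_sub, map_smul, smul_eq_mul, LinearMap.smul_apply] at this ⊢
  field_simp
  linarith

/-- The complement of a hyperplane is a maximal convex set. -/
theorem isIrreducibleConvex_polar_singleton [FiniteDimensional ℝ V] [FiniteDimensional ℝ W]
    [p.IsPerfPair] (x : ℙ ℝ V) : IsIrreducibleConvex (polar p {x}) := by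
  refine ⟨isConvexSet_polar p (singleton_nonempty x) (isSemiconvex_singleton x), ?_⟩
  intro B C hB _ hBC
  have hsub : polar p {x} ⊆ B := hBC ▸ inter_subset_left
  -- A hyperplane missing `B` also misses the smaller set `polar p {x}`, hence is the hyperplane of
  -- `x`; so `B` is no larger.
  obtain ⟨y, hy⟩ := polar_nonempty p.flip hB
  obtain rfl := polar_flip_polar_singleton_subset p x (polar_anti _ hsub hy)
  exact Or.inl (hsub.antisymm ((subset_polar_flip_polar p.flip B).trans
    (polar_anti p (singleton_subset_iff.2 hy))))

/-- For a set `S` with these separating hyperplanes, `S` is its own bipolar. -/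
theorem polar_flip_polar_of_separated {S : Set (ℙ ℝ V)}
    (h : ∀ v ≠ 0, v ∉ cone S → ∃ w ∈ cone (polar p S), p v w = 0) :
    polar p.flip (polar p S) = S := by
  refine (subset_polar_flip_polar p S).antisymm' (subset_of_cone_subset fun v hv ↦ ?_)
  by_contra hvS
  obtain ⟨w, hw, h0⟩ := h v hv.1 hvS
  exact ((mem_cone_polar _).1 hv).2 w hw h0

/-- A functional bounded below on a line vanishes there. -/
theorem eq_zero_of_forall_le_smul {f : Dual ℝ V} {v : V} {r : ℝ}
    (h : ∀ c : ℝ, r ≤ f (c • v)) : f v = 0 := by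
  by_contra hv
  have := h ((r - 1) / f v)
  rw [map_smul, smul_eq_mul, div_mul_cancel₀ _ hv] at this
  linarith

/-- The cone is symmetric under negation, so its half `f > 0` suffices. -/
theorem ne_zero_of_forall_pos {S : Set (ℙ ℝ V)} {f g : Dual ℝ V} (hf : ∀ v ∈ cone S, f v ≠ 0)
    (h : ∀ v ∈ cone S, 0 < f v → g v ≠ 0) : ∀ v ∈ cone S, g v ≠ 0 := by
  intro v hv
  rcases lt_or_gt_of_ne (hf v hv) with h0 | h0
  · have := h _ (smul_mem_cone hv (neg_ne_zero.2 one_ne_zero)) (by simpa using h0)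
    simpa using this
  · exact h v hv h0

theorem disjoint_cone_inter_pos_span {S : Set (ℙ ℝ V)} {f : Dual ℝ V} {v : V} (hv : v ∉ cone S) :
    Disjoint {u | u ∈ cone S ∧ 0 < f u} (ℝ ∙ v : Submodule ℝ V) := by
  rw [Set.disjoint_right]
  rintro _ hu ⟨hS, -⟩
  obtain ⟨c, rfl⟩ := Submodule.mem_span_singleton.1 hu
  have hc : c ≠ 0 := left_ne_zero_of_smul hS.1
  have := smul_mem_cone hS (inv_ne_zero hc)
  rw [inv_smul_smul₀ hc] at this
  exact hv this

theorem exists_mem_cone_polar [p.IsPerfPair] {S : Set (ℙ ℝ V)} (hne : S.Nonempty) {v : V}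
    {g : Dual ℝ V} (hg : ∀ u ∈ cone S, g u ≠ 0) (hv : g v = 0) :
    ∃ w ∈ cone (polar p S), p v w = 0 := by
  obtain ⟨w, rfl⟩ := exists_flip_eq p g
  obtain ⟨u, hu⟩ := cone_nonempty hne
  refine ⟨w, (mem_cone_polar p).2 ⟨fun h0 ↦ hg u hu ?_, hg⟩, hv⟩
  rw [h0, map_zero, LinearMap.zero_apply]

theorem isOpen_polar_singleton [FiniteDimensional ℝ W] [TopologicalSpace W] [IsModuleTopology ℝ W]
    (x : ℙ ℝ V) : IsOpen (polar p {x}) := by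
  induction x with | h v hv =>
  have := t2Space_of_isModuleTopology (V := W)
  have hc : Continuous (p v) := IsModuleTopology.continuous_of_linearMap _
  have e : cone (polar p {Projectivization.mk ℝ v hv}) = {w | p v w ≠ 0} := by
    ext w
    by_cases hw : w = 0
    · simp [hw, cone]
    · rw [← mk_mem_iff_mem_cone hw, mk_mem_polar_singleton, mem_ofPred_eq]
  rw [isOpen_iff_isOpen_cone, e]
  exact isOpen_ne_fun hc continuous_const

/-! ### Separation and bipolarity -/

variable [FiniteDimensional ℝ V] [TopologicalSpace V] [IsModuleTopology ℝ V] [p.IsPerfPair]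

/-- Separating from the whole line through `v`, not just from `v`, forces the functional to vanish
at `v`; it is then negative on the half cone. -/
theorem IsConvexSet.separated_of_isOpen {S : Set (ℙ ℝ V)} (hS : IsConvexSet S)
    (hne : S.Nonempty) (ho : IsOpen S) (v : V) (hv : v ∉ cone S) :
    ∃ w ∈ cone (polar p S), p v w = 0 := by
  have := IsModuleTopology.topologicalAddGroup ℝ V
  obtain ⟨hsc, f, -, hf⟩ := isConvexSet_iff.1 hS
  have hfc : Continuous f := IsModuleTopology.continuous_of_linearMap f
  obtain ⟨g, r, hg, hr⟩ := geometric_hahn_banach_open (convex_cone_inter_pos hsc f hf)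
    ((isOpen_iff_isOpen_cone.1 ho).inter (isOpen_lt continuous_const hfc))
    (Submodule.convex (ℝ ∙ v)) (disjoint_cone_inter_pos_span hv)
  have hr0 : r ≤ 0 := by simpa using hr 0 (zero_mem _)
  refine exists_mem_cone_polar p hne (g := g.toLinearMap)
    (ne_zero_of_forall_pos hf fun u hu hpos ↦ ((hg u ⟨hu, hpos⟩).trans_le hr0).ne)
    (eq_zero_of_forall_le_smul (r := r) fun c ↦
      hr _ (Submodule.smul_mem _ c (Submodule.mem_span_singleton_self v)))

theorem IsConvexSet.separated_of_isClosed {S : Set (ℙ ℝ V)} (hS : IsConvexSet S)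
    (hne : S.Nonempty) (hc : IsClosed S) (v : V) (hv : v ∉ cone S) :
    ∃ w ∈ cone (polar p S), p v w = 0 := by
  have := IsModuleTopology.topologicalAddGroup ℝ V
  have := t2Space_of_isModuleTopology (V := V)
  have := locallyConvexSpace_of_isModuleTopology (V := V)
  obtain ⟨hsc, f, -, hf⟩ := isConvexSet_iff.1 hS
  have hfc : Continuous f := IsModuleTopology.continuous_of_linearMap f
  obtain ⟨K, hK, hK0, hKrep⟩ := exists_isCompact_representatives V
  -- The half cone itself is not compact, but its slice `f = 1` is: it is the continuous image of `K
  -- ∩ cone S` under normalization by `f`.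
  have hcomp : IsCompact ((fun u ↦ (f u)⁻¹ • u) '' (K ∩ cone S)) :=
    (isCompact_inter_cone hc hK hK0).image_of_continuousOn
      ((hfc.continuousOn.inv₀ fun u hu ↦ hf u hu.2).smul continuousOn_id)
  have himage : (fun u ↦ (f u)⁻¹ • u) '' (K ∩ cone S) =
      {u | u ∈ cone S ∧ 0 < f u} ∩ {u | f u = 1} := by
    ext u
    constructor
    · rintro ⟨u, ⟨-, hu⟩, rfl⟩
      have h1 : f ((f u)⁻¹ • u) = 1 := by simp [hf u hu]
      exact ⟨⟨smul_mem_cone hu (inv_ne_zero (hf u hu)), by rw [h1]; exact one_pos⟩, h1⟩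
    · rintro ⟨⟨hu, -⟩, h1⟩
      obtain ⟨c, hc, hcK⟩ := hKrep u hu.1
      refine ⟨c • u, ⟨hcK, smul_mem_cone hu hc⟩, ?_⟩
      simp [show f u = 1 from h1, smul_smul, hc]
  rw [himage] at hcomp
  obtain ⟨g, r, s, hg, hrs, hs⟩ := geometric_hahn_banach_compact_closed
    ((convex_cone_inter_pos hsc f hf).inter (convex_hyperplane f.isLinear 1)) hcomp
    (Submodule.convex (ℝ ∙ v)) (Submodule.closed_of_finiteDimensional _)
    ((disjoint_cone_inter_pos_span hv).mono_left inter_subset_left)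
  have hs0 : s < 0 := by simpa using hs 0 (zero_mem _)
  refine exists_mem_cone_polar p hne (g := g.toLinearMap)
    (ne_zero_of_forall_pos hf fun u hu hpos h0 ↦ ?_)
    (eq_zero_of_forall_le_smul (r := s) fun c ↦
      (hs _ (Submodule.smul_mem _ c (Submodule.mem_span_singleton_self v))).le)
  have hu1 : f ((f u)⁻¹ • u) = 1 := by simp [hpos.ne']
  have := hg _ ⟨⟨smul_mem_cone hu (inv_ne_zero hpos.ne'), by rw [hu1]; exact one_pos⟩, hu1⟩
  have h0' : g u = 0 := h0
  rw [map_smul, h0', smul_zero] at this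
  linarith

theorem polar_flip_polar_of_isOpen {S : Set (ℙ ℝ V)} (hS : IsConvexSet S)
    (hne : S.Nonempty) (ho : IsOpen S) : polar p.flip (polar p S) = S :=
  polar_flip_polar_of_separated p fun v _ hv ↦ hS.separated_of_isOpen p hne ho v hv

/-- Bipolars are monotone, and each open convex set supplied by saturation is its own bipolar. -/
theorem polar_flip_polar {S : Set (ℙ ℝ V)} (hS : IsSaturatedConvex S)
    (hne : S.Nonempty) : polar p.flip (polar p S) = S := by
  refine (subset_polar_flip_polar p S).antisymm' fun x hx ↦ ?_
  by_contra hxS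
  obtain ⟨U, hUo, hU, hSU, hxU⟩ := hS.2.2 x hxS
  rw [← polar_flip_polar_of_isOpen p hU (hne.mono hSU) hUo] at hxU
  exact hxU (polar_anti _ (polar_anti _ hSU) hx)

/-! ### Openness, closedness and saturation of polars -/

variable [FiniteDimensional ℝ W] [TopologicalSpace W] [IsModuleTopology ℝ W]

theorem isClosed_polar_of_isOpen {S : Set (ℙ ℝ V)} (hS : IsOpen S) : IsClosed (polar p S) := by
  have := IsModuleTopology.topologicalAddGroup ℝ V
  have := t2Space_of_isModuleTopology (V := W)
  rw [← isOpen_compl_iff, isOpen_iff_isOpen_cone, isOpen_iff_mem_nhds]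
  have hcompl (w : W) : w ∈ cone (polar p S)ᶜ ↔ w ≠ 0 ∧ ∃ v ∈ cone S, p v w = 0 := by
    by_cases hw : w = 0
    · simp [hw, cone]
    · rw [← mk_mem_iff_mem_cone hw, mem_compl_iff, mk_mem_iff_mem_cone hw, mem_cone_polar]
      simp [hw]
  intro w hw
  obtain ⟨hw0, v, hv, h0⟩ := (hcompl w).1 hw
  obtain ⟨u, hu⟩ : ∃ u, p u w ≠ 0 := by
    by_contra! h
    exact pairing_ne_zero p.flip hw0 (LinearMap.ext h)
  have hcv : Continuous (p v) := IsModuleTopology.continuous_of_linearMap _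
  have hcu : Continuous (p u) := IsModuleTopology.continuous_of_linearMap _
  -- Moving `v` along `u` yields a zero of each nearby `y`; it equals `v` at `y = w`, so it stays in
  -- the open cone.
  have hcont : ContinuousAt (fun y ↦ v - (p v y / p u y) • u) w :=
    continuousAt_const.sub ((hcv.continuousAt.div hcu.continuousAt hu).smul continuousAt_const)
  have hnear := hcont.eventually_mem
    ((isOpen_iff_isOpen_cone.1 hS).mem_nhds (by simpa [h0] using hv))
  filter_upwards [hnear, hcu.continuousAt.eventually_ne hu, eventually_ne_nhds hw0] with y h1 h2 h3
  refine (hcompl y).2 ⟨h3, _, h1, ?_⟩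
  simp [h2]

-- Having no zero on the compact set `K ∩ cone S` is stable under small changes of the functional,
-- and `K` represents every point.
omit [p.IsPerfPair] in
theorem isOpen_polar_of_isClosed {S : Set (ℙ ℝ V)} (hS : IsClosed S) : IsOpen (polar p S) := by
  have := t2Space_of_isModuleTopology (V := W)
  obtain ⟨K, hK, hK0, hKrep⟩ := exists_isCompact_representatives V
  have hcomp := isCompact_inter_cone hS hK hK0
  rw [isOpen_iff_isOpen_cone, isOpen_iff_mem_nhds]
  intro w hw
  have hp : Continuous fun z : W × V ↦ p z.2 z.1 :=
    (IsModuleTopology.continuous_bilinear_of_finite_left p).comp continuous_swap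
  have hnear := hcomp.eventually_forall_of_forall_eventually (x₀ := w)
    (P := fun y v ↦ p v y ≠ 0) fun v hv ↦
      hp.continuousAt.eventually_ne (((mem_cone_polar p).1 hw).2 v hv.2)
  filter_upwards [hnear, eventually_ne_nhds hw.1] with y h1 h2
  refine (mem_cone_polar p).2 ⟨h2, fun v hv h0 ↦ ?_⟩
  obtain ⟨c, hc, hcK⟩ := hKrep v hv.1
  exact h1 _ ⟨hcK, smul_mem_cone hv hc⟩ (by simp [h0])

-- A point outside the polar vanishes at some `v` in the cone, and the complement of the hyperplane
-- of `v` is the required open convex set.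
omit [TopologicalSpace V] [IsModuleTopology ℝ V] in
theorem isSaturatedConvex_polar {S : Set (ℙ ℝ V)} (hne : S.Nonempty) (hS : IsSemiconvex S) :
    IsSaturatedConvex (polar p S) := by
  refine (isConvexSet_polar p hne hS).isSaturatedConvex fun y hy ↦ ?_
  obtain ⟨v, hv, h0⟩ : ∃ v ∈ cone S, p v y.rep = 0 := by simpa [polar] using hy
  refine ⟨polar p {Projectivization.mk ℝ v hv.1}, isOpen_polar_singleton p _,
    (isIrreducibleConvex_polar_singleton p _).1, polar_anti p (singleton_subset_iff.2 hv.2), ?_⟩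
  rw [← y.mk_rep, mk_mem_polar_singleton]
  exact not_not.2 h0

omit [TopologicalSpace W] [IsModuleTopology ℝ W] in
include p in
theorem isSaturatedConvex_of_isClosed {S : Set (ℙ ℝ V)} (hS : IsConvexSet S)
    (hne : S.Nonempty) (hc : IsClosed S) : IsSaturatedConvex S := by
  have h : polar p.flip (polar p S) = S :=
    polar_flip_polar_of_separated p fun v _ hv ↦ hS.separated_of_isClosed p hne hc v hv
  rw [← h]
  exact isSaturatedConvex_polar p.flip (polar_nonempty p hS) (isSemiconvex_polar p hne hS.1)

theorem isOpen_iff_isClosed_polar {S : Set (ℙ ℝ V)} (hne : S.Nonempty)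
    (hS : IsSaturatedConvex S) : IsOpen S ↔ IsClosed (polar p S) :=
  ⟨isClosed_polar_of_isOpen p, fun h ↦
    polar_flip_polar p hS hne ▸ isOpen_polar_of_isClosed p.flip h⟩

theorem isClosed_iff_isOpen_polar {S : Set (ℙ ℝ V)} (hne : S.Nonempty)
    (hS : IsSaturatedConvex S) : IsClosed S ↔ IsOpen (polar p S) :=
  ⟨isOpen_polar_of_isClosed p, fun h ↦
    polar_flip_polar p hS hne ▸ isClosed_polar_of_isOpen p.flip h⟩

/-- Polarity with respect to a perfect pairing, on the nonempty saturated convex sets. -/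
def polarOrderIso : {S : Set (ℙ ℝ V) // S.Nonempty ∧ IsSaturatedConvex S} ≃o
    {T : Set (ℙ ℝ W) // T.Nonempty ∧ IsSaturatedConvex T}ᵒᵈ where
  toFun S := OrderDual.toDual
    ⟨polar p S.1, polar_nonempty p S.2.2.1, isSaturatedConvex_polar p S.2.1 S.2.2.1.1⟩
  invFun T := ⟨polar p.flip (OrderDual.ofDual T).1,
    polar_nonempty p.flip (OrderDual.ofDual T).2.2.1,
    isSaturatedConvex_polar p.flip (OrderDual.ofDual T).2.1 (OrderDual.ofDual T).2.2.1.1⟩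
  left_inv S := Subtype.ext (polar_flip_polar p S.2.2 S.2.1)
  right_inv T := Subtype.ext
    (polar_flip_polar p.flip (OrderDual.ofDual T).2.2 (OrderDual.ofDual T).2.1)
  map_rel_iff' {S T} := by
    refine ⟨fun h ↦ ?_, fun h ↦ polar_anti p h⟩
    have := polar_anti p.flip (show polar p T.1 ⊆ polar p S.1 from h)
    rwa [polar_flip_polar p S.2.2 S.2.1, polar_flip_polar p T.2.2 T.2.1] at this

theorem bijOn_polar_isOpen : BijOn (polar p)
    {S | S.Nonempty ∧ IsOpen S ∧ IsConvexSet S} {T | T.Nonempty ∧ IsClosed T ∧ IsConvexSet T} := by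
  refine InvOn.bijOn (f' := polar p.flip) ⟨?_, ?_⟩ ?_ ?_
  · rintro S ⟨hne, ho, hS⟩
    exact polar_flip_polar_of_isOpen p hS hne ho
  · rintro T ⟨hne, hc, hT⟩
    exact polar_flip_polar p.flip (isSaturatedConvex_of_isClosed p.flip hT hne hc) hne
  · rintro S ⟨hne, ho, hS⟩
    exact ⟨polar_nonempty p hS, isClosed_polar_of_isOpen p ho, isConvexSet_polar p hne hS.1⟩
  · rintro T ⟨hne, hc, hT⟩
    exact ⟨polar_nonempty p.flip hT, isOpen_polar_of_isClosed p.flip hc,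
      isConvexSet_polar p.flip hne hT.1⟩

theorem bijOn_polar_isClosed : BijOn (polar p)
    {S | S.Nonempty ∧ IsClosed S ∧ IsConvexSet S} {T | T.Nonempty ∧ IsOpen T ∧ IsConvexSet T} :=
  (bijOn_polar_isOpen p.flip).symm (g := polar p) ⟨fun _ hS ↦
    polar_flip_polar p (isSaturatedConvex_of_isClosed p hS.2.2 hS.1 hS.2.1) hS.1,
    fun _ hT ↦ polar_flip_polar_of_isOpen p.flip hT.2.2 hT.1 hT.2.1⟩

end Polar

/-! ### Identification of Φ with polarity -/

section Dual

variable {V : Type*} [AddCommGroup V] [Module ℝ V]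

theorem compl_hyperplaneOfDual (y : ℙ ℝ (Dual ℝ V)) :
    (hyperplaneOfDual y)ᶜ = polar LinearMap.id {y} := by
  ext x
  induction y with | h f hf =>
  induction x with | h v hv =>
  rw [mem_compl_iff, mk_mem_hyperplaneOfDual, mk_mem_polar_singleton]
  rfl

theorem compl_hyperplaneOfPoint (x : ℙ ℝ V) :
    (hyperplaneOfPoint x)ᶜ = polar (LinearMap.id (R := ℝ) (M := Dual ℝ V)).flip {x} := by
  ext y
  induction y with | h f hf =>
  induction x with | h v hv =>
  rw [mem_compl_iff, mk_mem_hyperplaneOfPoint, mk_mem_polar_singleton]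
  rfl

theorem subset_polar_singleton_iff {W : Type*} [AddCommGroup W] [Module ℝ W]
    (p : V →ₗ[ℝ] W →ₗ[ℝ] ℝ) {S : Set (ℙ ℝ W)} {x : ℙ ℝ V} :
    S ⊆ polar p {x} ↔ x ∈ polar p.flip S :=
  ⟨fun h ↦ polar_anti p.flip h (subset_polar_flip_polar p {x} rfl), fun h ↦
    (subset_polar_flip_polar p.flip S).trans (polar_anti p (singleton_subset_iff.2 h))⟩

theorem Phi_eq_polar [FiniteDimensional ℝ V] (S : Set (ℙ ℝ V)) :
    Phi S = polar (LinearMap.id (R := ℝ) (M := Dual ℝ V)).flip S := by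
  ext y
  rw [← subset_polar_singleton_iff, ← compl_hyperplaneOfDual]
  -- Irreducibility in the definition of `Phi` is automatic for hyperplane complements.
  refine ⟨fun ⟨_, _, hS, h⟩ ↦ h ▸ hS, fun h ↦ ⟨_, ?_, h, rfl⟩⟩
  rw [compl_hyperplaneOfDual]
  exact isIrreducibleConvex_polar_singleton _ y

theorem PhiDual_eq_polar [FiniteDimensional ℝ V] (T : Set (ℙ ℝ (Dual ℝ V))) :
    PhiDual T = polar (LinearMap.id (R := ℝ) (M := Dual ℝ V)) T := by
  ext x
  rw [← LinearMap.flip_flip (LinearMap.id (R := ℝ) (M := Dual ℝ V)),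
    ← subset_polar_singleton_iff, ← compl_hyperplaneOfPoint]
  refine ⟨fun ⟨_, _, hT, h⟩ ↦ h ▸ hT, fun h ↦ ⟨_, ?_, h, rfl⟩⟩
  rw [compl_hyperplaneOfPoint]
  exact isIrreducibleConvex_polar_singleton _ x

end Dual

end ProjConvex

theorem mainTheorem6 {V : Type*} [AddCommGroup V] [Module ℝ V] [FiniteDimensional ℝ V] :
    -- an order anti-isomorphism given by `Φ`, whose inverse is given by the dual `Φ`
    (∃ e : {S : Set (ℙ ℝ V) // S.Nonempty ∧ ProjConvex.IsSaturatedConvex S} ≃o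
        {T : Set (ℙ ℝ (Module.Dual ℝ V)) // T.Nonempty ∧ ProjConvex.IsSaturatedConvex T}ᵒᵈ,
      (∀ S, (OrderDual.ofDual (e S)).1 = ProjConvex.Phi S.1) ∧
      (∀ T, (e.symm (OrderDual.toDual T)).1 = ProjConvex.PhiDual T.1)) ∧
    -- openness and closedness are interchanged
    (∀ S : Set (ℙ ℝ V), S.Nonempty → ProjConvex.IsSaturatedConvex S →
      (IsOpen S ↔ IsClosed (ProjConvex.Phi S)) ∧ (IsClosed S ↔ IsOpen (ProjConvex.Phi S))) ∧
    Set.BijOn ProjConvex.Phi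
      {S : Set (ℙ ℝ V) | S.Nonempty ∧ IsOpen S ∧ ProjConvex.IsConvexSet S}
      {T : Set (ℙ ℝ (Module.Dual ℝ V)) | T.Nonempty ∧ IsClosed T ∧ ProjConvex.IsConvexSet T} ∧
    Set.BijOn ProjConvex.Phi
      {S : Set (ℙ ℝ V) | S.Nonempty ∧ IsClosed S ∧ ProjConvex.IsConvexSet S}
      {T : Set (ℙ ℝ (Module.Dual ℝ V)) | T.Nonempty ∧ IsOpen T ∧ ProjConvex.IsConvexSet T} := by
  let tV : TopologicalSpace V := moduleTopology ℝ V
  have : IsModuleTopology ℝ V := ⟨rfl⟩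
  let tW : TopologicalSpace (Module.Dual ℝ V) := moduleTopology ℝ (Module.Dual ℝ V)
  have : IsModuleTopology ℝ (Module.Dual ℝ V) := ⟨rfl⟩
  let p : V →ₗ[ℝ] Module.Dual ℝ V →ₗ[ℝ] ℝ :=
    (LinearMap.id (R := ℝ) (M := Module.Dual ℝ V)).flip
  have hp : p.IsPerfPair := .flip .id
  have hPhi : ProjConvex.Phi = ProjConvex.polar p := funext ProjConvex.Phi_eq_polar
  rw [hPhi]
  refine ⟨⟨ProjConvex.polarOrderIso p, fun _ ↦ rfl, fun T ↦ ?_⟩, fun S hne hS ↦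
    ⟨ProjConvex.isOpen_iff_isClosed_polar p hne hS, ProjConvex.isClosed_iff_isOpen_polar p hne hS⟩,
    ProjConvex.bijOn_polar_isOpen p, ProjConvex.bijOn_polar_isClosed p⟩
  exact (ProjConvex.PhiDual_eq_polar T.1).symm
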